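/- Let $M$ be a structure of finite Morley rank in the sense of Borovik and Poizat: every set interpretable in $M$ (definable set of tuples, with parameters, modulo a definable equivalence relation) has a finite rank, where non-empty sets have rank $\geq 0$ and $\operatorname{rk}(X)\geq k+1$ if and only if $X$ contains infinitely many pairwise disjoint definable subsets of rank $\geq k$; the rank is definable (for every definable map $f:X\to Y$ and every $k$, the set $\{y\in Y:\operatorname{rk}f^{-1}(y)=k\}$ is definable) and additive (if $f:X\to Y$ is a definable surjection all of whose fibres have rank $k$, then $\operatorname{rk}X=\operatorname{rk}Y+k$); and for every definable $f:X\to Y$ there is an $N$ such that every fibre of $f$ with at least $N$ elements is infinite. Let $G$ be a group and $V$ an abelian group (written additively), both interpretable in $M$, and let $G$ act definably on $V$ by group automorphisms. Assume that $V$ is connected (it has no proper definable subgroup of finite index), has rank $n\geq 1$ and contains no element of order $2$. Let $m\geq n$, and assume that the action is generically sharply $m$-transitive: $G$ has an orbit on $V^m$ (with the coordinatewise action) that is generic, i.e. definable of rank $\operatorname{rk}(V^m)$, and on which point stabilisers are trivial. Let $A\subseteq V^m$ be the generic orbit of $G$. Then for every $\bar a=(v_1,\dots,v_m)\in A$ the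 following hold. 1. For each $i\in\{1,\dots,m\}$ there is a unique $e_i\in G$ with $e_i(v_1,\dots,v_m)=(v_1,\dots,-v_i,\dots,v_m)$, and for each $\sigma\in\mathrm{Sym}_m$ there is a unique $s_\sigma\in G$ with $s_\sigma(v_1,\dots,v_m)=(v_{\sigma(1)},\dots,v_{\sigma(m)})$. 2. The setwise stabiliser $\Sigma_{\bar a}$ in $G$ of the set $\{\pm v_1,\dots,\pm v_m\}$ is the subgroup generated by all $e_i$ and all $s_\sigma$. 3. $\Sigma_{\bar a}$ is isomorphic to the hyperoctahedral group $\mathrm{Sym}_m\ltimes(\mathbb Z_2)^m$ (with $\mathrm{Sym}_m$ permuting the factors), by an isomorphism under which the $i$-th standard generator of $(\mathbb Z_2)^m$ corresponds to $e_i$ and $\sigma\in\mathrm{Sym}_m$ to $s_\sigma$. Moreover, $m=n$. -/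

import Mathlib

open scoped Pointwise

universe u w₁ w₂ v₁ v₂

/-- A presentation of the type `X` as an interpretable set of the first-order structure `M`:
a finite index set `ι` and a surjective partial map from `M ^ ι` onto `X` (`rep a x` says that the
tuple `a` is sent to `x`) whose kernel is definable with parameters in `M`. Thus `X` is identified
with a definable set of tuples modulo a definable equivalence relation; the domain of the partial
map is the diagonal of its kernel, so it is definable too. -/
structure Interpretation (L : FirstOrder.Language.{w₁, w₂}) (M : Type v₁) [L.Structure M]
    (X : Type v₂) where
  ι : Type
  finite_ι : Finite ι
  rep : (ι → M) → X → Prop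
  functional : ∀ a x y, rep a x → rep a y → x = y
  surjective : ∀ x, ∃ a, rep a x
  definable_ker : (Set.univ : Set M).Definable L
    {c : ι ⊕ ι → M | ∃ x, rep (c ∘ Sum.inl) x ∧ rep (c ∘ Sum.inr) x}

namespace Interpretation

variable {L : FirstOrder.Language.{w₁, w₂}} {M : Type v₁} [L.Structure M]
  {X : Type v₂} {Y : Type v₂}

/-- A subset of an interpretable set is definable if the set of tuples that represent its
elements is definable with parameters. -/
def DefinableSet (I : Interpretation L M X) (S : Set X) : Prop :=
  (Set.univ : Set M).Definable L {a : I.ι → M | ∃ x ∈ S, I.rep a x}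

/-- The product of two interpretable sets. -/
def prod (I : Interpretation L M X) (J : Interpretation L M Y) : Interpretation L M (X × Y) where
  ι := I.ι ⊕ J.ι
  finite_ι := by
    have := I.finite_ι
    have := J.finite_ι
    infer_instance
  rep a p := I.rep (a ∘ Sum.inl) p.1 ∧ J.rep (a ∘ Sum.inr) p.2
  functional a p q hp hq :=
    Prod.ext (I.functional _ _ _ hp.1 hq.1) (J.functional _ _ _ hp.2 hq.2)
  surjective p := by
    obtain ⟨a, ha⟩ := I.surjective p.1
    obtain ⟨b, hb⟩ := J.surjective p.2
    exact ⟨Sum.elim a b, by simpa using ha, by simpa using hb⟩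
  definable_ker := by
    have h₁ := I.definable_ker.preimage_comp
      (Sum.map Sum.inl Sum.inl : I.ι ⊕ I.ι → (I.ι ⊕ J.ι) ⊕ (I.ι ⊕ J.ι))
    have h₂ := J.definable_ker.preimage_comp
      (Sum.map Sum.inr Sum.inr : J.ι ⊕ J.ι → (I.ι ⊕ J.ι) ⊕ (I.ι ⊕ J.ι))
    convert h₁.inter h₂ using 1
    ext c
    constructor
    · rintro ⟨p, ⟨h1, h2⟩, h3, h4⟩
      exact ⟨⟨p.1, h1, h3⟩, ⟨p.2, h2, h4⟩⟩
    · rintro ⟨⟨x, h1, h3⟩, ⟨y, h2, h4⟩⟩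
      exact ⟨(x, y), ⟨h1, h2⟩, h3, h4⟩

/-- The power `X ^ m` of an interpretable set. -/
def pow (I : Interpretation L M X) (m : ℕ) : Interpretation L M (Fin m → X) where
  ι := Fin m × I.ι
  finite_ι := by
    have := I.finite_ι
    infer_instance
  rep a x := ∀ i, I.rep (fun j => a (i, j)) (x i)
  functional a x y hx hy := funext fun i => I.functional _ _ _ (hx i) (hy i)
  surjective x := by
    choose a ha using fun i => I.surjective (x i)
    exact ⟨fun p => a p.1 p.2, ha⟩
  definable_ker := by
    have h := fun i : Fin m => I.definable_ker.preimage_comp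
      (Sum.map (fun j => (i, j)) (fun j => (i, j)) :
        I.ι ⊕ I.ι → (Fin m × I.ι) ⊕ (Fin m × I.ι))
    convert Set.definable_iInter_of_finite h using 1
    ext c
    simp only [Set.mem_ofPred_eq, Set.mem_iInter, Set.mem_preimage]
    constructor
    · rintro ⟨x, h1, h2⟩ i
      exact ⟨x i, h1 i, h2 i⟩
    · intro H
      choose x hx using H
      exact ⟨x, fun i => (hx i).1, fun i => (hx i).2⟩

/-- A map between interpretable sets is definable if its graph is. -/
def DefinableMap (I : Interpretation L M X) (J : Interpretation L M Y) (f : X → Y) : Prop :=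
  (I.prod J).DefinableSet {p | f p.1 = p.2}

/-- `I.RankGE k A` says `rk A ≥ k`: non-empty sets have rank at least `0`, and `rk A ≥ k + 1` if
and only if `A` contains infinitely many pairwise disjoint definable subsets of rank at least `k`.
(The empty set has no rank.) -/
def RankGE (I : Interpretation L M X) : ℕ → Set X → Prop
  | 0, A => A.Nonempty
  | k + 1, A => ∃ B : ℕ → Set X,
      (∀ i, I.DefinableSet (B i) ∧ B i ⊆ A ∧ I.RankGE k (B i)) ∧
        ∀ i j, i ≠ j → Disjoint (B i) (B j)

/-- `I.HasRank A k` says `rk A = k`. -/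
def HasRank (I : Interpretation L M X) (A : Set X) (k : ℕ) : Prop :=
  I.RankGE k A ∧ ¬ I.RankGE (k + 1) A

/-- A definable subset of an interpretable set `X` is generic if it has the same rank as `X`. -/
def IsGeneric (I : Interpretation L M X) (A : Set X) : Prop :=
  I.DefinableSet A ∧ ∃ k, I.HasRank A k ∧ I.HasRank Set.univ k

end Interpretation

/-- `M` is a ranked structure, that is, a structure of finite Morley rank in the sense of Borovik
and Poizat: every interpretable set has finite rank, where the rank is defined by Morley's
recursion on the definable subsets (`Interpretation.RankGE`), the rank is definable and additive
in definable families, and infinite quantifiers are eliminated. -/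
structure IsRanked (L : FirstOrder.Language.{w₁, w₂}) (M : Type u) [L.Structure M] : Prop where
  finite_rank : ∀ (X : Type u) (I : Interpretation L M X), ∃ k, ¬ I.RankGE k Set.univ
  definable_rank : ∀ (X Y : Type u) (I : Interpretation L M X) (J : Interpretation L M Y)
    (f : X → Y), I.DefinableMap J f → ∀ k, J.DefinableSet {y | I.HasRank (f ⁻¹' {y}) k}
  additive_rank : ∀ (X Y : Type u) (I : Interpretation L M X) (J : Interpretation L M Y)
    (f : X → Y), I.DefinableMap J f → f.Surjective → ∀ k l : ℕ,
      (∀ y, I.HasRank (f ⁻¹' {y}) k) → J.HasRank Set.univ l → I.HasRank Set.univ (l + k)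
  elim_infinite : ∀ (X Y : Type u) (I : Interpretation L M X) (J : Interpretation L M Y)
    (f : X → Y), I.DefinableMap J f →
      ∃ N : ℕ, ∀ y, (N : ℕ∞) ≤ (f ⁻¹' {y}).encard → (f ⁻¹' {y}).Infinite

section Groups

variable {L : FirstOrder.Language.{w₁, w₂}} {M : Type u} [L.Structure M]

/-- An interpretable group: the multiplication is definable. -/
def IsDefinableGroup {G : Type u} [Group G] (I : Interpretation L M G) : Prop :=
  (I.prod I).DefinableMap I fun p => p.1 * p.2

/-- An interpretable group, written additively: the addition is definable. -/
def IsDefinableAddGroup {V : Type u} [AddGroup V] (J : Interpretation L M V) : Prop :=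
  (J.prod J).DefinableMap J fun p => p.1 + p.2

/-- The action of `G` on `V` is definable. -/
def IsDefinableAction {G V : Type u} [SMul G V] (I : Interpretation L M G)
    (J : Interpretation L M V) : Prop :=
  (I.prod J).DefinableMap J fun p => p.1 • p.2

/-- A group is connected if it has no proper definable subgroup of finite index. -/
def IsConnectedGroup {V : Type u} [AddGroup V] (J : Interpretation L M V) : Prop :=
  ∀ H : AddSubgroup V, J.DefinableSet (H : Set V) → H.FiniteIndex → H = ⊤

/-- `A` is a generic orbit of the coordinatewise action of `G` on `V ^ m`. -/
def IsGenericOrbit (G : Type u) {V : Type u} [Group G] [MulAction G V] (J : Interpretation L M V)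
    (m : ℕ) (A : Set (Fin m → V)) : Prop :=
  (J.pow m).IsGeneric A ∧ ∃ a, A = MulAction.orbit G a

/-- The action of `G` on `V` is generically sharply `m`-transitive: `G` has a generic orbit on
`V ^ m` on which the point stabilisers are trivial. -/
def IsGenericallySharplyTransitive (G : Type u) {V : Type u} [Group G] [MulAction G V]
    (J : Interpretation L M V) (m : ℕ) : Prop :=
  ∃ A : Set (Fin m → V), IsGenericOrbit G J m A ∧ ∀ a ∈ A, MulAction.stabilizer G a = ⊥

end Groups

/-- The hyperoctahedral group `(Z_2)^m ⋊ Sym_m`, where `σ` sends the `i`-th generator of `(Z_2)^m`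
to the `σ i`-th one. -/
abbrev HyperoctahedralGroup (m : ℕ) : Type :=
  (Fin m → Multiplicative (ZMod 2)) ⋊[mulAutArrow] Equiv.Perm (Fin m)

/-! Connectedness of $V$ passes to $V^m$, and in a connected abelian group of finite Morley rank any
two generic definable sets meet (`IsGeneric.inter_nonempty`). Hence $V^m$ has only one generic
orbit. A signed permutation of the coordinates is a definable bijection of $V^m$ that commutes with
$G$, so it maps $A$ to a generic orbit, that is, to $A$ itself (`IsGenericOrbit.exists_smul_eq`).
Every signed permutation of $\bar a$ is therefore $g\bar a$ for some $g\in G$, unique because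
stabilisers are trivial. The entries $v_i$ are non-zero and there is no 2-torsion, so distinct
signed permutations give distinct tuples, and these $g$ form the hyperoctahedral group
(`exists_hyperoctahedral_equiv`).

For $m\leq n$, let $F_k$ be the subgroup of $V$ fixed by $e_0,\dots,e_{k-1}$ (indices from $0$). The
map $q=\prod_{j<k}(1+e_j)$ sends $V$ into $F_k$, and $(1-e_k)q$ sends $v_k$ to $2^{k+1}v_k\neq 0$.
So the kernel of $(1-e_k)q$ is a proper definable subgroup, of infinite index because $V$ is
connected. Thus $F_k$ contains infinitely many cosets of $F_{k+1}$, and each of the $m$ steps from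
$F_m$ to $F_0=V$ raises the rank (`rankGE_of_sign_changes`). -/

/-! ### Calculus of definable sets and maps. -/

namespace Interpretation

variable {L : FirstOrder.Language.{w₁, w₂}} {M : Type v₁} [L.Structure M]
  {X Y Z W : Type v₂} {I : Interpretation L M X} {J : Interpretation L M Y}
  {K : Interpretation L M Z} {K' : Interpretation L M W}

variable (I) in
theorem definableSet_univ : I.DefinableSet Set.univ := by
  have h := I.definable_ker.preimage_comp (Sum.elim id id)
  unfold DefinableSet
  convert h using 1
  ext a
  simp [Function.comp_def]

theorem DefinableSet.compl {S : Set X} (h : I.DefinableSet S) : I.DefinableSet Sᶜ := by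
  have h' := Set.Definable.sdiff I.definableSet_univ h
  unfold DefinableSet
  convert h' using 1
  ext a
  constructor
  · rintro ⟨x, hx, ha⟩
    refine ⟨⟨x, trivial, ha⟩, ?_⟩
    rintro ⟨y, hy, hay⟩
    exact hx (I.functional _ _ _ ha hay ▸ hy)
  · rintro ⟨⟨x, -, ha⟩, h⟩
    exact ⟨x, fun hx => h ⟨x, hx, ha⟩, ha⟩

theorem DefinableSet.union {S T : Set X} (hS : I.DefinableSet S) (hT : I.DefinableSet T) :
    I.DefinableSet (S ∪ T) := by
  have h' := Set.Definable.union hS hT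
  unfold DefinableSet
  convert h' using 1
  ext a
  simp only [Set.mem_union, Set.mem_ofPred_eq, or_and_right, exists_or]

theorem DefinableSet.inter {S T : Set X} (hS : I.DefinableSet S) (hT : I.DefinableSet T) :
    I.DefinableSet (S ∩ T) := by
  simpa [Set.compl_union] using (hS.compl.union hT.compl).compl

theorem DefinableSet.sdiff {S T : Set X} (hS : I.DefinableSet S) (hT : I.DefinableSet T) :
    I.DefinableSet (S \ T) := hS.inter hT.compl

theorem DefinableSet.iUnion {ι : Type*} [Finite ι] {S : ι → Set X}
    (h : ∀ i, I.DefinableSet (S i)) : I.DefinableSet (⋃ i, S i) := by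
  have h' := Set.definable_iUnion_of_finite h
  unfold DefinableSet
  convert h' using 1
  ext a
  simp only [Set.mem_iUnion, Set.mem_ofPred_eq]
  tauto

theorem DefinableSet.iInter {ι : Type*} [Finite ι] {S : ι → Set X}
    (h : ∀ i, I.DefinableSet (S i)) : I.DefinableSet (⋂ i, S i) := by
  simpa [Set.compl_iUnion] using (DefinableSet.iUnion fun i => (h i).compl).compl

/-- Maps that are given by a reindexing of representing tuples pull definable sets back to
definable sets. -/
theorem DefinableSet.preimage_reindex (r : J.ι → I.ι) {φ : X → Y}
    (hφ : ∀ a x, I.rep a x → J.rep (a ∘ r) (φ x)) {S : Set Y} (hS : J.DefinableSet S) :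
    I.DefinableSet (φ ⁻¹' S) := by
  have h := Set.Definable.inter I.definableSet_univ (hS.preimage_comp r)
  unfold DefinableSet
  convert h using 1
  ext a
  constructor
  · rintro ⟨x, hx, ha⟩
    exact ⟨⟨x, trivial, ha⟩, φ x, hx, hφ _ _ ha⟩
  · rintro ⟨⟨x, -, ha⟩, y, hy, hay⟩
    refine ⟨x, ?_, ha⟩
    rw [J.functional _ _ _ hay (hφ _ _ ha)] at hy
    exact hy

theorem DefinableSet.exists {S : Set (X × Y)} (h : (I.prod J).DefinableSet S) :
    I.DefinableSet {x | ∃ y, (x, y) ∈ S} := by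
  have := J.finite_ι
  have h' := Set.Definable.exists_of_finite h
  unfold DefinableSet
  convert h' using 1
  ext a
  constructor
  · rintro ⟨x, ⟨y, hy⟩, ha⟩
    obtain ⟨b, hb⟩ := J.surjective y
    exact ⟨b, (x, y), hy, by simpa [prod] using And.intro ha hb⟩
  · rintro ⟨b, ⟨x, y⟩, hy, h⟩
    exact ⟨x, ⟨y, hy⟩, by simpa [prod] using h.1⟩

variable (I) in
theorem definableSet_eq : (I.prod I).DefinableSet {p | p.1 = p.2} := by
  have h := I.definable_ker
  have he : {c : I.ι ⊕ I.ι → M | ∃ x, I.rep (c ∘ Sum.inl) x ∧ I.rep (c ∘ Sum.inr) x} =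
      {a | ∃ p ∈ {p : X × X | p.1 = p.2}, (I.prod I).rep a p} := by
    ext a
    constructor
    · rintro ⟨x, h⟩
      exact ⟨(x, x), rfl, h⟩
    · rintro ⟨⟨x, y⟩, hp, h⟩
      obtain rfl : x = y := hp
      exact ⟨x, h⟩
  rw [he] at h
  exact h

variable (I) in
theorem definableSet_singleton (c : X) : I.DefinableSet {c} := by
  obtain ⟨b, hb⟩ := I.surjective c
  have := I.finite_ι
  -- The representative `b` enters as parameters: extra variables are set equal to it and then
  -- quantified away.
  have h1 : (Set.univ : Set M).Definable L {d : I.ι ⊕ I.ι → M | ∀ j, d (Sum.inr j) = b j} := by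
    have h2 : ∀ j : I.ι, (Set.univ : Set M).Definable L
        {d : I.ι ⊕ I.ι → M | d (Sum.inr j) = b j} := fun j => by
      have h3 := Set.Definable.singleton_of_mem L (Set.mem_univ (b j))
      exact h3.preimage_comp (fun _ => (Sum.inr j : I.ι ⊕ I.ι))
    convert Set.definable_iInter_of_finite h2 using 1
    ext d
    simp
  have h := (I.definable_ker.inter h1).exists_of_finite
  unfold DefinableSet
  convert h using 1
  ext a
  constructor
  · rintro ⟨x, rfl, ha⟩
    exact ⟨b, ⟨x, by simpa using ha, by simpa using hb⟩, by simp⟩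
  · rintro ⟨u, ⟨x, hx, hx'⟩, h3⟩
    obtain rfl : u = b := funext fun j => by simpa using h3 j
    simp only [Sum.elim_comp_inl, Sum.elim_comp_inr] at hx hx'
    exact ⟨c, rfl, I.functional _ _ _ hx' hb ▸ hx⟩

theorem DefinableSet.preimage_fst {S : Set X} (h : I.DefinableSet S) :
    (I.prod J).DefinableSet (Prod.fst ⁻¹' S) :=
  h.preimage_reindex (I := I.prod J) Sum.inl fun _ _ h => h.1

theorem DefinableSet.preimage_snd {S : Set Y} (h : J.DefinableSet S) :
    (I.prod J).DefinableSet (Prod.snd ⁻¹' S) :=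
  h.preimage_reindex (I := I.prod J) Sum.inr fun _ _ h => h.2

theorem DefinableMap.preimage {f : X → Y} (hf : I.DefinableMap J f) {S : Set Y}
    (hS : J.DefinableSet S) : I.DefinableSet (f ⁻¹' S) := by
  have h := (DefinableSet.inter hf hS.preimage_snd).exists
  convert h using 1
  ext x
  simp

theorem definableMap_of_reindex (r : J.ι → I.ι) {φ : X → Y}
    (hφ : ∀ a x, I.rep a x → J.rep (a ∘ r) (φ x)) : I.DefinableMap J φ :=
  DefinableSet.preimage_reindex (I := I.prod J) (J := J.prod J) (φ := fun p => (φ p.1, p.2))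
    (Sum.map r id) (fun _ _ h => ⟨hφ _ _ h.1, h.2⟩) J.definableSet_eq

variable (I) in
theorem definableMap_id : I.DefinableMap I fun x => x := I.definableSet_eq

variable (I J) in
theorem definableMap_fst : (I.prod J).DefinableMap I fun p => p.1 :=
  definableMap_of_reindex (I := I.prod J) (J := I) Sum.inl fun _ _ h => h.1

variable (I J) in
theorem definableMap_snd : (I.prod J).DefinableMap J fun p => p.2 :=
  definableMap_of_reindex (I := I.prod J) (J := J) Sum.inr fun _ _ h => h.2

variable (I J) in
theorem definableMap_const (c : Y) : I.DefinableMap J fun _ => c := by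
  have h := (J.definableSet_singleton c).preimage_snd (I := I)
  unfold DefinableMap
  convert h using 1
  ext p
  simp [eq_comm]

theorem DefinableMap.pair {f : X → Y} {g : X → Z} (hf : I.DefinableMap J f)
    (hg : I.DefinableMap K g) : I.DefinableMap (J.prod K) fun x => (f x, g x) := by
  have h1 := DefinableSet.preimage_reindex (I := I.prod (J.prod K)) (J := I.prod J)
    (φ := fun p => (p.1, p.2.1)) (Sum.map id Sum.inl)
    (fun a x h => ⟨h.1, h.2.1⟩) hf
  have h2 := DefinableSet.preimage_reindex (I := I.prod (J.prod K)) (J := I.prod K)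
    (φ := fun p => (p.1, p.2.2)) (Sum.map id Sum.inr)
    (fun a x h => ⟨h.1, h.2.2⟩) hg
  have h := h1.inter h2
  unfold DefinableMap
  convert h using 1
  ext p
  simp [Prod.ext_iff]

/-- Used for composition: the graph of $g\circ f$ is the preimage of the graph of $g$ under
$f\times\mathrm{id}$. -/
theorem DefinableMap.fiber_prod {f : X → Y} (hf : I.DefinableMap J f) :
    (I.prod K).DefinableMap (J.prod K) fun p => (f p.1, p.2) := by
  have h1 := DefinableSet.preimage_reindex (I := (I.prod K).prod (J.prod K)) (J := I.prod J)
    (φ := fun p => (p.1.1, p.2.1)) (Sum.map Sum.inl Sum.inl)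
    (fun a x h => ⟨h.1.1, h.2.1⟩) hf
  have h2 := DefinableSet.preimage_reindex (I := (I.prod K).prod (J.prod K)) (J := K.prod K)
    (φ := fun p => (p.1.2, p.2.2)) (Sum.map Sum.inr Sum.inr)
    (fun a x h => ⟨h.1.2, h.2.2⟩) K.definableSet_eq
  have h := h1.inter h2
  unfold DefinableMap
  convert h using 1
  ext p
  simp [Prod.ext_iff]

theorem DefinableMap.comp {g : Y → Z} {f : X → Y} (hg : J.DefinableMap K g)
    (hf : I.DefinableMap J f) : I.DefinableMap K fun x => g (f x) :=
  (hf.fiber_prod (K := K)).preimage hg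

theorem DefinableMap.definableSet_eq {f g : X → Y} (hf : I.DefinableMap J f)
    (hg : I.DefinableMap J g) : I.DefinableSet {x | f x = g x} :=
  (hf.pair hg).preimage J.definableSet_eq

theorem DefinableMap.image {f : X → Y} (hf : I.DefinableMap J f) {S : Set X}
    (hS : I.DefinableSet S) : J.DefinableSet (f '' S) := by
  have h1 := DefinableSet.inter hf hS.preimage_fst
  have h2 := ((J.definableMap_snd I).pair (J.definableMap_fst I)).preimage h1
  convert h2.exists using 1
  ext y
  simp [and_comm]

theorem definableMap_apply {m : ℕ} (i : Fin m) : (I.pow m).DefinableMap I fun x => x i :=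
  definableMap_of_reindex (I := I.pow m) (J := I) (fun j => (i, j)) fun _ _ h => h i

theorem DefinableMap.pi {m : ℕ} {f : X → Fin m → Y} (h : ∀ i, I.DefinableMap J fun x => f x i) :
    I.DefinableMap (J.pow m) f := by
  have h1 := fun i => ((I.definableMap_fst (J.pow m)).pair
    ((definableMap_apply i).comp (I.definableMap_snd (J.pow m)))).preimage (h i)
  have h2 := DefinableSet.iInter h1
  unfold DefinableMap
  convert h2 using 1
  ext p
  simp [funext_iff]

/-- A definable subset of an interpretable set is interpretable. -/
def sub (I : Interpretation L M X) (S : Set X) (hS : I.DefinableSet S) :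
    Interpretation L M S where
  ι := I.ι
  finite_ι := I.finite_ι
  rep a x := I.rep a x
  functional a x y hx hy := Subtype.ext (I.functional _ _ _ hx hy)
  surjective x := I.surjective x
  definable_ker := by
    have h := hS.preimage_comp (Sum.inl : I.ι → I.ι ⊕ I.ι)
    convert I.definable_ker.inter h using 1
    ext c
    constructor
    · rintro ⟨x, h1, h2⟩
      exact ⟨⟨x, h1, h2⟩, x, x.2, h1⟩
    · rintro ⟨⟨x, h1, h2⟩, y, hy, h3⟩
      obtain rfl := I.functional _ _ _ h1 h3
      exact ⟨⟨x, hy⟩, h1, h2⟩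

theorem definableMap_val {S : Set X} (hS : I.DefinableSet S) :
    (I.sub S hS).DefinableMap I fun x => x.1 :=
  definableMap_of_reindex (I := I.sub S hS) (J := I) id fun _ _ h => h

theorem DefinableMap.codRestrict {S : Set Y} (hS : J.DefinableSet S) {f : X → S}
    (h : I.DefinableMap J fun x => (f x).1) : I.DefinableMap (J.sub S hS) f := by
  have h1 := ((I.definableMap_fst (J.sub S hS)).pair
    ((definableMap_val hS).comp (I.definableMap_snd (J.sub S hS)))).preimage h
  unfold DefinableMap
  convert h1 using 1
  ext p
  simp [Subtype.ext_iff]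

end Interpretation

/-! ### Elementary properties of the rank. -/

namespace Interpretation

section Rank

variable {L : FirstOrder.Language.{w₁, w₂}} {M : Type v₁} [L.Structure M]
  {X Y : Type v₂} {I : Interpretation L M X} {J : Interpretation L M Y}

theorem RankGE.mono {k : ℕ} {A B : Set X} (h : I.RankGE k A) (hAB : A ⊆ B) : I.RankGE k B := by
  cases k with
  | zero => exact Set.Nonempty.mono hAB h
  | succ k =>
    obtain ⟨C, hC, hd⟩ := h
    exact ⟨C, fun i => ⟨(hC i).1, (hC i).2.1.trans hAB, (hC i).2.2⟩, hd⟩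

theorem RankGE.of_succ {k : ℕ} {A : Set X} (h : I.RankGE (k + 1) A) : I.RankGE k A := by
  obtain ⟨B, hB, -⟩ := h
  exact (hB 0).2.2.mono (hB 0).2.1

theorem RankGE.of_le {k l : ℕ} {A : Set X} (h : I.RankGE k A) (hlk : l ≤ k) : I.RankGE l A := by
  induction k, hlk using Nat.le_induction with
  | base => exact h
  | succ k _ ih => exact ih h.of_succ

theorem RankGE.nonempty {k : ℕ} {A : Set X} (h : I.RankGE k A) : A.Nonempty :=
  h.of_le (Nat.zero_le k)

theorem HasRank.le_of_rankGE {k l : ℕ} {A : Set X} (h : I.HasRank A k) (hl : I.RankGE l A) :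
    l ≤ k := by
  by_contra! hlt
  exact h.2 (hl.of_le hlt)

theorem HasRank.unique {k l : ℕ} {A : Set X} (hk : I.HasRank A k) (hl : I.HasRank A l) : k = l :=
  le_antisymm (hl.le_of_rankGE hk.1) (hk.le_of_rankGE hl.1)

theorem exists_hasRank {N : ℕ} {A : Set X} (hA : A.Nonempty) (hN : ¬ I.RankGE N A) :
    ∃ k < N, I.HasRank A k := by
  induction N with
  | zero => exact absurd hA hN
  | succ N ih =>
    by_cases h : I.RankGE N A
    · exact ⟨N, N.lt_succ_self, h, hN⟩
    · obtain ⟨k, hk, hr⟩ := ih h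
      exact ⟨k, hk.trans N.lt_succ_self, hr⟩

/-- By induction, each $B_i$ of a family witnessing rank $k+1$ has a large part inside or outside
$C$; one of the two alternatives occurs for infinitely many $i$. -/
theorem RankGE.inter_or_sdiff {k : ℕ} {A C : Set X} (hC : I.DefinableSet C)
    (h : I.RankGE k A) : I.RankGE k (A ∩ C) ∨ I.RankGE k (A \ C) := by
  induction k generalizing A with
  | zero =>
    obtain ⟨x, hx⟩ := h
    by_cases hxC : x ∈ C
    · exact Or.inl ⟨x, hx, hxC⟩
    · exact Or.inr ⟨x, hx, hxC⟩
  | succ k ih =>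
    obtain ⟨B, hB, hd⟩ := h
    have key : ∀ (P : ℕ → Prop) (D : Set X), I.DefinableSet D → {i | P i}.Infinite →
        (∀ i, P i → I.RankGE k (B i ∩ D)) → I.RankGE (k + 1) (A ∩ D) := by
      intro P D hD hinf hP
      refine ⟨fun i => B (Nat.nth P i) ∩ D, fun i => ⟨(hB _).1.inter hD,
        Set.inter_subset_inter_left _ (hB _).2.1, hP _ (Nat.nth_mem_of_infinite hinf i)⟩, ?_⟩
      intro i j hij
      exact (hd _ _ fun h => hij (Nat.nth_injective hinf h)).mono
        Set.inter_subset_left Set.inter_subset_left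
    by_cases hinf : {i | I.RankGE k (B i ∩ C)}.Infinite
    · exact Or.inl (key _ C hC hinf fun i hi => hi)
    · refine Or.inr (key (fun i => ¬ I.RankGE k (B i ∩ C)) Cᶜ hC.compl ?_ ?_)
      · exact (Set.not_infinite.1 hinf).infinite_compl
      · exact fun i hi => (ih (hB i).2.2).resolve_left hi

theorem RankGE.exists_of_iUnion {k N : ℕ} {A : Set X} {C : ℕ → Set X}
    (hC : ∀ i, I.DefinableSet (C i)) (h : I.RankGE k A) (hA : A ⊆ ⋃ i < N, C i) :
    ∃ i < N, I.RankGE k (A ∩ C i) := by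
  induction N generalizing A with
  | zero =>
    obtain ⟨x, hx⟩ := h.nonempty
    simpa using hA hx
  | succ N ih =>
    rcases h.inter_or_sdiff (hC N) with h' | h'
    · exact ⟨N, N.lt_succ_self, h'⟩
    · obtain ⟨i, hi, hr⟩ := ih h' (by
        rintro x ⟨hx, hxN⟩
        have := hA hx
        simp only [Set.mem_iUnion, exists_prop] at this ⊢
        obtain ⟨i, hi, hxi⟩ := this
        rcases Nat.lt_succ_iff_lt_or_eq.1 hi with h | rfl
        · exact ⟨i, h, hxi⟩
        · exact absurd hxi hxN)
      exact ⟨i, hi.trans N.lt_succ_self,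
        hr.mono (Set.inter_subset_inter_left _ Set.sdiff_subset)⟩

/-- Definable sets of rank at least `k` whose pairwise intersections are smaller raise the rank. -/
theorem rankGE_succ_of_inter {k : ℕ} {T : ℕ → Set X} (hT : ∀ i, I.DefinableSet (T i))
    (hr : ∀ i, I.RankGE k (T i)) (hd : ∀ i j, i ≠ j → ¬ I.RankGE k (T i ∩ T j)) :
    I.RankGE (k + 1) Set.univ := by
  have hU : ∀ i, I.DefinableSet (⋃ j < i, T j) := fun i => by
    have h : (⋃ j < i, T j) = ⋃ j : Fin i, T j := by
      ext x
      simp only [Set.mem_iUnion, exists_prop]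
      exact ⟨fun ⟨j, hj, hx⟩ => ⟨⟨j, hj⟩, hx⟩, fun ⟨j, hx⟩ => ⟨j, j.2, hx⟩⟩
    rw [h]
    exact DefinableSet.iUnion fun _ => hT _
  -- Removing the earlier sets makes the family disjoint. No rank is lost: otherwise $T_i$ would
  -- meet one of the finitely many earlier sets in rank at least $k$.
  refine ⟨fun i => T i \ ⋃ j < i, T j, fun i => ⟨(hT i).sdiff (hU i), Set.subset_univ _, ?_⟩, ?_⟩
  · refine ((hr i).inter_or_sdiff (hU i)).resolve_left fun h => ?_
    obtain ⟨j, hj, hr'⟩ := h.exists_of_iUnion hT Set.inter_subset_right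
    exact hd i j hj.ne'
      (hr'.mono (Set.inter_subset_inter_left _ Set.inter_subset_left))
  · have key : ∀ i j, i < j → Disjoint (T i \ ⋃ l < i, T l) (T j \ ⋃ l < j, T l) := by
      intro i j hij
      refine Set.disjoint_left.2 fun x hx hx' => hx'.2 ?_
      simp only [Set.mem_iUnion, exists_prop]
      exact ⟨i, hij, hx.1⟩
    intro i j hij
    rcases lt_or_gt_of_ne hij with h | h
    · exact key i j h
    · exact (key j i h).symm

/-- The rank depends only on definable subsets, and a definable injection transports disjoint
families of these in both directions. -/
theorem rankGE_image_iff {k : ℕ} {f : X → Y} (hf : I.DefinableMap J f) {S : Set X}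
    (hS : I.DefinableSet S) (hinj : Set.InjOn f S) : J.RankGE k (f '' S) ↔ I.RankGE k S := by
  induction k generalizing S with
  | zero => exact Set.image_nonempty
  | succ k ih =>
    constructor
    · rintro ⟨C, hC, hd⟩
      refine ⟨fun i => S ∩ f ⁻¹' C i, fun i => ?_, fun i j hij => ?_⟩
      · have hdef := hS.inter (hf.preimage (hC i).1)
        refine ⟨hdef, Set.inter_subset_left, ?_⟩
        rw [← ih hdef (hinj.mono Set.inter_subset_left), Set.image_inter_preimage,
          Set.inter_eq_right.2 (hC i).2.1]
        exact (hC i).2.2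
      · exact ((hd i j hij).preimage f).mono Set.inter_subset_right Set.inter_subset_right
    · rintro ⟨B, hB, hd⟩
      refine ⟨fun i => f '' B i, fun i => ⟨hf.image (hB i).1, Set.image_mono (hB i).2.1,
        (ih (hB i).1 (hinj.mono (hB i).2.1)).2 (hB i).2.2⟩, fun i j hij => ?_⟩
      refine Set.disjoint_left.2 ?_
      rintro _ ⟨x, hx, rfl⟩ ⟨y, hy, hxy⟩
      rw [hinj ((hB j).2.1 hy) ((hB i).2.1 hx) hxy] at hy
      exact Set.disjoint_left.1 (hd i j hij) hx hy

theorem hasRank_image_iff {k : ℕ} {f : X → Y} (hf : I.DefinableMap J f) {S : Set X}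
    (hS : I.DefinableSet S) (hinj : Set.InjOn f S) : J.HasRank (f '' S) k ↔ I.HasRank S k :=
  and_congr (rankGE_image_iff hf hS hinj) (not_congr (rankGE_image_iff hf hS hinj))

theorem hasRank_sub_iff {k : ℕ} {S : Set X} (hS : I.DefinableSet S) :
    (I.sub S hS).HasRank Set.univ k ↔ I.HasRank S k := by
  rw [← hasRank_image_iff (definableMap_val hS) (definableSet_univ _)
    Subtype.val_injective.injOn]
  simp

/-- Every definable set of rank at least `k` but not `k + 1` contains one that has no two disjoint
definable subsets of rank at least `k`. -/
theorem exists_indecomposable {k : ℕ} {A : Set X} (hA : I.DefinableSet A) (hk : I.RankGE k A)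
    (hk' : ¬ I.RankGE (k + 1) A) :
    ∃ S ⊆ A, I.DefinableSet S ∧ I.RankGE k S ∧ ∀ P Q, P ⊆ S → Q ⊆ S → I.DefinableSet P →
      I.DefinableSet Q → I.RankGE k P → I.RankGE k Q → (P ∩ Q).Nonempty := by
  by_contra! hcon
  choose! P Q hPS hQS hP hQ hPr hQr hPQ using hcon
  -- Splitting repeatedly and keeping the half `P` leaves behind infinitely many disjoint halves `Q`
  -- of rank at least $k$.
  let S : ℕ → Set X := fun i => P^[i] A
  have hS : ∀ i, S i ⊆ A ∧ I.DefinableSet (S i) ∧ I.RankGE k (S i) := by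
    intro i
    induction i with
    | zero => exact ⟨subset_rfl, hA, hk⟩
    | succ i ih =>
      simp only [S, Function.iterate_succ_apply'] at ih ⊢
      obtain ⟨h1, h2, h3⟩ := ih
      exact ⟨(hPS _ h1 h2 h3).trans h1, hP _ h1 h2 h3, hPr _ h1 h2 h3⟩
  have hmono : Antitone S := antitone_nat_of_succ_le fun i => by
    obtain ⟨h1, h2, h3⟩ := hS i
    have := hPS _ h1 h2 h3
    simpa only [S, Function.iterate_succ_apply'] using this
  have key : ∀ i j, i < j → Disjoint (Q (S i)) (Q (S j)) := by
    intro i j hij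
    obtain ⟨h1, h2, h3⟩ := hS i
    obtain ⟨h1', h2', h3'⟩ := hS j
    have h4 : Q (S j) ⊆ P (S i) := by
      refine (hQS _ h1' h2' h3').trans ((hmono hij).trans ?_)
      simp only [S, Function.iterate_succ_apply', subset_rfl]
    refine (Set.disjoint_iff_inter_eq_empty.2 ?_).symm
    exact Set.subset_empty_iff.1
      ((Set.inter_subset_inter_left _ h4).trans (hPQ _ h1 h2 h3).subset)
  refine hk' ⟨fun i => Q (S i), fun i => ?_, fun i j hij => ?_⟩
  · obtain ⟨h1, h2, h3⟩ := hS i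
    exact ⟨hQ _ h1 h2 h3, (hQS _ h1 h2 h3).trans h1, hQr _ h1 h2 h3⟩
  · rcases lt_or_gt_of_ne hij with h | h
    · exact key i j h
    · exact (key j i h).symm

end Rank

/-! ### Definability and additivity of rank for sections of a definable relation. -/

section Fibres

variable {L : FirstOrder.Language.{w₁, w₂}} {M : Type u} [L.Structure M]
  {X Y : Type u} {I : Interpretation L M X} {J : Interpretation L M Y}

theorem hasRank_fibre_iff {E : Set (X × Y)} (hE : (I.prod J).DefinableSet E) {T : Set E}
    (hT : ((I.prod J).sub E hE).DefinableSet T) {y : Y} (hTy : ∀ p : E, p ∈ T ↔ p.1.2 = y)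
    {k : ℕ} : ((I.prod J).sub E hE).HasRank T k ↔ I.HasRank {x | (x, y) ∈ E} k := by
  rw [← hasRank_image_iff ((I.definableMap_fst J).comp (definableMap_val hE)) hT]
  · have h : (fun p : E => p.1.1) '' T = {x | (x, y) ∈ E} := by
      ext x
      constructor
      · rintro ⟨p, hp, rfl⟩
        rw [hTy] at hp
        subst hp
        exact p.2
      · intro hx
        exact ⟨⟨(x, y), hx⟩, (hTy _).2 rfl, rfl⟩
    rw [h]
  · intro p hp q hq hpq
    rw [hTy] at hp hq
    exact Subtype.ext (Prod.ext hpq (hp.trans hq.symm))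

theorem _root_.IsRanked.definableSet_hasRank (hM : IsRanked L M) {E : Set (X × Y)}
    (hE : (I.prod J).DefinableSet E) (k : ℕ) :
    J.DefinableSet {y | I.HasRank {x | (x, y) ∈ E} k} := by
  have hf := (I.definableMap_snd J).comp (definableMap_val hE)
  convert hM.definable_rank _ _ _ _ _ hf k using 3 with y
  exact (hasRank_fibre_iff hE (hf.preimage (J.definableSet_singleton y)) fun _ => Iff.rfl).symm

theorem _root_.IsRanked.hasRank_of_fibres (hM : IsRanked L M) {E : Set (X × Y)}
    (hE : (I.prod J).DefinableSet E) {D : Set Y} (hD : J.DefinableSet D) {k l : ℕ}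
    (hED : ∀ p ∈ E, p.2 ∈ D) (hk : ∀ y ∈ D, I.HasRank {x | (x, y) ∈ E} k)
    (hl : J.HasRank D l) : (I.prod J).HasRank E (l + k) := by
  let f : E → D := fun p => ⟨p.1.2, hED _ p.2⟩
  have hf : ((I.prod J).sub E hE).DefinableMap (J.sub D hD) f :=
    DefinableMap.codRestrict hD ((I.definableMap_snd J).comp (definableMap_val hE))
  rw [← hasRank_sub_iff hE]
  refine hM.additive_rank _ _ _ _ f hf ?_ k l ?_ ((hasRank_sub_iff hD).2 hl)
  · rintro ⟨y, hy⟩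
    obtain ⟨x, hx⟩ := (hk y hy).1.nonempty
    exact ⟨⟨(x, y), hx⟩, rfl⟩
  · rintro ⟨y, hy⟩
    exact (hasRank_fibre_iff hE (hf.preimage (definableSet_singleton _ _))
      fun p => by simp [f]).2 (hk y hy)

end Fibres

end Interpretation

/-! ### Generic sets in connected abelian groups. -/

namespace Interpretation

variable {L : FirstOrder.Language.{w₁, w₂}} {M : Type u} [L.Structure M]
  {X W : Type u} {I : Interpretation L M X} [AddCommGroup W] {K : Interpretation L M W}

theorem DefinableMap.add (hK : IsDefinableAddGroup K) {f g : X → W} (hf : I.DefinableMap K f)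
    (hg : I.DefinableMap K g) : I.DefinableMap K fun x => f x + g x :=
  DefinableMap.comp hK (hf.pair hg)

theorem definableMap_neg (hK : IsDefinableAddGroup K) : K.DefinableMap K fun x => -x := by
  have h := (((K.definableMap_fst K).add hK (K.definableMap_snd K))).definableSet_eq
    (definableMap_const _ K 0)
  unfold DefinableMap
  convert h using 1
  ext p
  simp [neg_eq_iff_add_eq_zero]

theorem definableMap_add_const (hK : IsDefinableAddGroup K) (g : W) :
    K.DefinableMap K fun x => x + g :=
  K.definableMap_id.add hK (K.definableMap_const K g)

theorem rankGE_translate (hK : IsDefinableAddGroup K) {k : ℕ} (g : W) {S : Set W}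
    (hS : K.DefinableSet S) : K.RankGE k {x | x + g ∈ S} ↔ K.RankGE k S := by
  have hg := definableMap_add_const hK g
  have h := rankGE_image_iff (k := k) hg (hg.preimage hS) (add_left_injective g).injOn
  rw [Set.image_preimage_eq _ (add_right_surjective g)] at h
  exact h.symm

/-- Representatives of distinct cosets; this is how infinite index is turned into a lower bound for
the rank. -/
theorem _root_.AddSubgroup.exists_seq_sub_notMem {W : Type*} [AddCommGroup W] {H : AddSubgroup W}
    (hH : ¬ H.FiniteIndex) : ∃ c : ℕ → W, ∀ i j, i ≠ j → c i - c j ∉ H := by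
  have hinf : Infinite (W ⧸ H) := by
    rw [← not_finite_iff_infinite]
    exact fun _ => hH H.finiteIndex_of_finite_quotient
  refine ⟨fun i => (Infinite.natEmbedding (W ⧸ H) i).out, fun i j hij h => hij ?_⟩
  refine (Infinite.natEmbedding (W ⧸ H)).injective ?_
  rw [← QuotientAddGroup.out_eq' (Infinite.natEmbedding (W ⧸ H) i),
    ← QuotientAddGroup.out_eq' (Infinite.natEmbedding (W ⧸ H) j), eq_comm, QuotientAddGroup.eq]
  rwa [neg_add_eq_sub]

/-- In a ranked connected abelian group, a generic set without two disjoint generic subsets is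
almost invariant under translations. -/
theorem rankGE_inter_translate (hM : IsRanked L M) (hK : IsDefinableAddGroup K)
    (hconn : IsConnectedGroup K) {N : ℕ} (hN : ¬ K.RankGE (N + 1) Set.univ) {S : Set W}
    (hS : K.DefinableSet S) (hSN : K.RankGE N S)
    (hind : ∀ P Q, P ⊆ S → Q ⊆ S → K.DefinableSet P → K.DefinableSet Q → K.RankGE N P →
      K.RankGE N Q → (P ∩ Q).Nonempty) (g : W) : K.RankGE N {x | x ∈ S ∧ x + g ∈ S} := by
  have hdef : ∀ g, K.DefinableSet {x | x ∈ S ∧ x + g ∈ S} := fun g =>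
    hS.inter ((definableMap_add_const hK g).preimage hS)
  have hinter : ∀ P Q, P ⊆ S → Q ⊆ S → K.DefinableSet P → K.DefinableSet Q → K.RankGE N P →
      K.RankGE N Q → K.RankGE N (P ∩ Q) := by
    intro P Q hP hQ hPd hQd hPr hQr
    refine (hPr.inter_or_sdiff hQd).resolve_right fun h => ?_
    obtain ⟨x, hx, hx'⟩ := hind _ _ (Set.sdiff_subset.trans hP) hQ (hPd.sdiff hQd) hQd h hQr
    exact hx.2 hx'
  -- The almost-stabiliser of $S$. It is closed under addition because large subsets of $S$ meet in
  -- large sets.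
  let H : AddSubgroup W :=
    { carrier := {g | K.RankGE N {x | x ∈ S ∧ x + g ∈ S}}
      zero_mem' := by simpa using hSN
      neg_mem' := by
        intro g hg
        rw [Set.mem_ofPred_eq, ← rankGE_translate hK g (hdef (-g))]
        simpa [and_comm] using hg
      add_mem' := by
        intro a b ha hb
        have h1 : K.RankGE N {x | x ∈ S ∧ x + -a ∈ S} := by
          rw [← rankGE_translate hK a (hdef (-a))]
          simpa [and_comm] using ha
        have h2 := hinter _ _ (fun x hx => hx.1) (fun x hx => hx.1) (hdef (-a)) (hdef b) h1 hb
        rw [← rankGE_translate hK a ((hdef (-a)).inter (hdef b))] at h2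
        refine h2.mono ?_
        rintro x ⟨⟨-, h3⟩, -, h4⟩
        exact ⟨by simpa using h3, by simpa [add_assoc] using h4⟩ }
  have hH : ∀ g, g ∈ H ↔ K.RankGE N {x | x ∈ S ∧ x + g ∈ S} := fun _ => Iff.rfl
  have hHdef : K.DefinableSet (H : Set W) := by
    have hE : (K.prod K).DefinableSet {p | p.1 ∈ S ∧ p.1 + p.2 ∈ S} :=
      hS.preimage_fst.inter (DefinableMap.preimage hK hS)
    convert hM.definableSet_hasRank hE N using 1
    ext g
    exact ⟨fun h => ⟨h, fun h' => hN (h'.mono (Set.subset_univ _))⟩, fun h => h.1⟩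
  have hfin : H.FiniteIndex := by
    by_contra hinf
    obtain ⟨c, hc⟩ := AddSubgroup.exists_seq_sub_notMem hinf
    -- If `H` had infinite index, translates of $S$ by representatives of its cosets would have
    -- pairwise small intersections and push the rank of the group above $N$.
    refine hN (rankGE_succ_of_inter (T := fun i => {x | x + -c i ∈ S})
      (fun i => (definableMap_add_const hK _).preimage hS)
      (fun i => (rankGE_translate hK _ hS).2 hSN) fun i j hij h => hc i j hij ?_)
    rw [hH, ← rankGE_translate hK (-c i) (hdef _)]
    refine h.mono ?_
    rintro x ⟨h1, h2⟩
    refine ⟨h1, ?_⟩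
    have h3 : x + -c i + (c i - c j) = x + -c j := by abel
    exact (congrArg (· ∈ S) h3).mpr h2
  rw [← hH, hconn H hHdef hfin]
  trivial

/-- Two generic subsets of a ranked connected abelian group intersect. -/
theorem IsGeneric.inter_nonempty (hM : IsRanked L M) (hK : IsDefinableAddGroup K)
    (hconn : IsConnectedGroup K) {A B : Set W} (hA : K.IsGeneric A) (hB : K.IsGeneric B) :
    (A ∩ B).Nonempty := by
  obtain ⟨hAd, N, hAN, hN⟩ := hA
  obtain ⟨hBd, N', hBN, hN'⟩ := hB
  obtain rfl := hN.unique hN'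
  obtain ⟨S, hSA, hS, hSN, hind⟩ := exists_indecomposable hAd hAN.1 hAN.2
  have htop : ∀ T, K.RankGE N T → K.HasRank T N := fun T hT =>
    ⟨hT, fun h => hN.2 (h.mono (Set.subset_univ _))⟩
  have hinv := rankGE_inter_translate hM hK hconn hN.2 hS hSN hind
  by_contra hAB
  -- Inside $S$, the large set $S\cap(S-g)$ would meet $S\cap(B-g)$ if the latter were large, giving
  -- a point of $S\cap B$.
  have hfib : ∀ g, ¬ K.RankGE N {x | x ∈ S ∧ x + g ∈ B} := by
    intro g hg
    obtain ⟨x, h1, h2⟩ := hind _ _ (fun x hx => hx.1) (fun x hx => hx.1)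
      (hS.inter ((definableMap_add_const hK g).preimage hS))
      (hS.inter ((definableMap_add_const hK g).preimage hBd)) (hinv g) hg
    exact hAB ⟨x + g, hSA h1.2, h2.2⟩
  have hE : (K.prod K).DefinableSet {p | p.1 ∈ S ∧ p.1 + p.2 ∈ B} :=
    hS.preimage_fst.inter (DefinableMap.preimage hK hBd)
  have hswap : (K.prod K).DefinableMap (K.prod K) Prod.swap :=
    (K.definableMap_snd K).pair (K.definableMap_fst K)
  -- The rank of $E=\{(x,g) : x\in S,\ x+g\in B\}$ is now counted in two ways. Over each $x\in S$
  -- the fibre is a translate of $B$, so the rank is $2N$; the swap is needed since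
  -- `IsRanked.hasRank_of_fibres` fibres over the second coordinate.
  have hE2 : (K.prod K).HasRank {p | p.1 ∈ S ∧ p.1 + p.2 ∈ B} (N + N) := by
    have h1 := hM.hasRank_of_fibres (hswap.preimage hE) hS (k := N) (fun p hp => hp.1)
      (fun y hy => htop _ ?_) (htop _ hSN)
    · rw [← hasRank_image_iff hswap (hswap.preimage hE) Prod.swap_injective.injOn,
        Set.image_preimage_eq _ Prod.swap_surjective] at h1
      exact h1
    · refine RankGE.mono ((rankGE_translate hK y hBd).2 hBN.1) fun x hx => ⟨hy, ?_⟩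
      rw [add_comm]
      exact hx
  have hD := fun k => hM.definableSet_hasRank hE k
  -- Over each $g$ the fibre has rank below $N$. One of the finitely many pieces on which this rank
  -- is constant carries the full rank $2N$, yet its rank is $l+k$ with $l\leq N$ and $k<N$.
  obtain ⟨k, hk, hEk⟩ := hE2.1.exists_of_iUnion (N := N) (fun k => (hD k).preimage_snd) (by
    rintro ⟨x, g⟩ hp
    obtain ⟨k, hk, hr⟩ := exists_hasRank ⟨x, hp⟩ (hfib g)
    simp only [Set.mem_iUnion, exists_prop]
    exact ⟨k, hk, hr⟩)
  obtain ⟨⟨x, g⟩, hp, hg⟩ := hEk.nonempty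
  obtain ⟨l, hl, hDl⟩ := exists_hasRank (I := K) (N := N + 1)
    (A := {g | K.HasRank {x | x ∈ S ∧ x + g ∈ B} k}) ⟨g, hg⟩
    fun h => hN.2 (h.mono (Set.subset_univ _))
  have h2 := hM.hasRank_of_fibres (hE.inter (hD k).preimage_snd) (hD k) (k := k)
    (fun p hp => hp.2) (fun y hy => ?_) hDl
  · have := h2.le_of_rankGE hEk
    omega
  · have hy' : K.HasRank {x | x ∈ S ∧ x + y ∈ B} k := hy
    convert hy' using 1
    ext x
    exact ⟨fun h => h.1, fun h => ⟨h, hy⟩⟩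

theorem isDefinableAddGroup_pow (hK : IsDefinableAddGroup K) (m : ℕ) :
    IsDefinableAddGroup (K.pow m) :=
  DefinableMap.pi fun i =>
    ((definableMap_apply i).comp (definableMap_fst _ _)).add hK
      ((definableMap_apply i).comp (definableMap_snd _ _))

/-- A definable subgroup of finite index pulls back to all of $W$ along each coordinate embedding,
and the coordinate copies of $W$ generate the power. -/
theorem isConnectedGroup_pow (hconn : IsConnectedGroup K) (m : ℕ) :
    IsConnectedGroup (K.pow m) := by
  intro H hH hfin
  have key : ∀ i, H.comap (AddMonoidHom.single (fun _ : Fin m => W) i) = ⊤ := by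
    intro i
    refine hconn _ (DefinableMap.preimage (J := K.pow m) (DefinableMap.pi fun j => ?_) hH)
      ⟨by rw [AddSubgroup.index_comap]
          exact AddSubgroup.FiniteIndex.index_ne_zero (H := H.addSubgroupOf _)⟩
    by_cases hij : j = i
    · subst hij
      simpa using K.definableMap_id
    · simpa [hij] using K.definableMap_const K 0
  refine (eq_top_iff).2 fun x _ => AddSubgroup.pi_mem_of_single_mem x fun i => ?_
  have : x i ∈ H.comap (AddMonoidHom.single (fun _ : Fin m => W) i) := by simp [key]
  exact this

/-- A generic set is not contained in a proper definable subgroup. -/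
theorem IsGeneric.eq_top_of_subset (hM : IsRanked L M) (hK : IsDefinableAddGroup K)
    (hconn : IsConnectedGroup K) {A : Set W} (hA : K.IsGeneric A) {H : AddSubgroup W}
    (hAH : A ⊆ H) : H = ⊤ := by
  refine (eq_top_iff).2 fun g _ => ?_
  have hg := definableMap_add_const hK g
  have hB : K.IsGeneric {x | x + g ∈ A} := by
    obtain ⟨hAd, N, hAN, hN⟩ := hA
    exact ⟨hg.preimage hAd, N, ⟨(rankGE_translate hK g hAd).2 hAN.1,
      fun h => hAN.2 ((rankGE_translate hK g hAd).1 h)⟩, hN⟩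
  -- Since $A$ meets $A-g$, the element $g$ is a difference of two elements of $A$.
  obtain ⟨x, hx, hx'⟩ := hA.inter_nonempty hM hK hconn hB
  exact (H.add_mem_cancel_left (hAH hx)).1 (hAH hx')

end Interpretation

/-! ### Signed permutations of a tuple. -/

/-- The isomorphism from `Z_2` to the group of signs. -/
def zmodTwoSign : Multiplicative (ZMod 2) →* ℤˣ where
  toFun a := if a = 1 then 1 else -1
  map_one' := by decide
  map_mul' := by decide

theorem zmodTwoSign_injective : Function.Injective zmodTwoSign := by decide

theorem zmodTwoSign_ofAdd_one : zmodTwoSign (Multiplicative.ofAdd (1 : ZMod 2)) = -1 := by decide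

section SignedPermutations

variable {G V : Type*} [Group G] [AddCommGroup V] [DistribMulAction G V] {m : ℕ} {v : Fin m → V}

theorem smul_units_smul (g : G) (ε : ℤˣ) (x : V) : g • (ε • x) = ε • (g • x) := by
  rcases Int.units_eq_one_or ε with rfl | rfl <;> simp

theorem eq_of_units_smul_eq (hinv : ∀ x : V, x + x = 0 → x = 0) {x : V} (hx : x ≠ 0)
    {ε δ : ℤˣ} (h : ε • x = δ • x) : ε = δ := by
  rcases Int.units_eq_one_or ε with rfl | rfl <;> rcases Int.units_eq_one_or δ with rfl | rfl <;>
    simp only [one_smul, Units.neg_smul] at h ⊢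
  · exact absurd (hinv x (add_eq_zero_iff_eq_neg.2 h)) hx
  · exact absurd (hinv x (add_eq_zero_iff_eq_neg.2 h.symm)) hx

theorem mem_range_union_neg_iff {x : V} :
    x ∈ Set.range v ∪ Set.range (-v) ↔ ∃ (ε : ℤˣ) (i : Fin m), x = ε • v i := by
  constructor
  · rintro (⟨i, rfl⟩ | ⟨i, rfl⟩)
    · exact ⟨1, i, by simp⟩
    · exact ⟨-1, i, by simp⟩
  · rintro ⟨ε, i, rfl⟩
    rcases Int.units_eq_one_or ε with rfl | rfl
    · exact Or.inl ⟨i, by simp⟩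
    · exact Or.inr ⟨i, by simp⟩

/-- If a group contains all signed permutations of a tuple with trivial stabiliser, then they form
a hyperoctahedral group, which is the setwise stabiliser of the entries and their negatives. -/
theorem exists_hyperoctahedral_equiv (hinv : ∀ x : V, x + x = 0 → x = 0) (h0 : ∀ i, v i ≠ 0)
    (hfree : ∀ g h : G, g • v = h • v → g = h)
    (hex : ∀ (ε : Fin m → ℤˣ) (σ : Equiv.Perm (Fin m)),
      ∃ g : G, g • v = fun i => ε (σ i) • v (σ i)) :
    ∃ (e : Fin m → G) (s : Equiv.Perm (Fin m) → G),
      (∀ i g, g • v = Function.update v i (-v i) ↔ g = e i) ∧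
      (∀ σ g, (g • v = fun i => v (σ i)) ↔ g = s σ) ∧
      MulAction.stabilizer G (Set.range v ∪ Set.range (-v)) =
        Subgroup.closure (Set.range e ∪ Set.range s) ∧
      ∃ Φ : HyperoctahedralGroup m ≃*
          MulAction.stabilizer G (Set.range v ∪ Set.range (-v)),
        (∀ i, (Φ (SemidirectProduct.inl
          (Pi.mulSingle i (Multiplicative.ofAdd (1 : ZMod 2)))) : G) = e i) ∧
        ∀ σ, (Φ (SemidirectProduct.inr σ) : G) = s σ := by
  choose f hf using hex
  have hf' : ∀ ε σ i, f ε σ • v i = ε (σ i) • v (σ i) := fun ε σ i => congrFun (hf ε σ) i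
  -- If $v_i=\pm v_j$ with $i\neq j$, the element changing only the sign of $v_i$ would both negate
  -- and fix this vector.
  have hne : ∀ i j (ε δ : ℤˣ), ε • v i = δ • v j → i = j := by
    intro i j ε δ h
    by_contra hij
    have hi := hf' (Pi.mulSingle i (-1)) 1 i
    have hj := hf' (Pi.mulSingle i (-1)) 1 j
    simp only [Equiv.Perm.one_apply, Pi.mulSingle_eq_same,
      Pi.mulSingle_eq_of_ne (Ne.symm hij), one_smul] at hi hj
    have h' := congrArg (f (Pi.mulSingle i (-1)) 1 • ·) h
    simp only [smul_units_smul (G := G), hi, hj] at h'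
    rw [← h, smul_smul] at h'
    have := eq_of_units_smul_eq hinv (h0 i) h'
    simp at this
  let F : HyperoctahedralGroup m →* G := MonoidHom.mk'
    -- Signs are attached to the target index $\sigma(i)$, which matches the action in the
    -- semidirect product.
    (fun h => f (fun i => zmodTwoSign (h.left i)) h.right) (by
      intro a b
      refine hfree _ _ (funext fun i => ?_)
      rw [mul_smul, Pi.smul_apply, Pi.smul_apply, Pi.smul_apply, hf', hf', smul_units_smul, hf',
        smul_smul]
      congr 1
      rw [SemidirectProduct.mul_left, Pi.mul_apply, map_mul, mul_comm]
      congr 2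
      change b.left (a.right⁻¹ (a.right (b.right i))) = _
      simp)
  have hF : ∀ h i, F h • v i = zmodTwoSign (h.left (h.right i)) • v (h.right i) := fun h i =>
    hf' _ _ i
  have hFinj : Function.Injective F := by
    refine (injective_iff_map_eq_one F).2 fun h hh => ?_
    have h1 : ∀ i, v i = zmodTwoSign (h.left (h.right i)) • v (h.right i) := fun i => by
      rw [← hF, hh, one_smul]
    have h2 : ∀ i, h.right i = i := fun i =>
      (hne i _ 1 _ (by rw [one_smul]; exact h1 i)).symm
    refine SemidirectProduct.ext (funext fun i => zmodTwoSign_injective ?_) (Equiv.ext h2)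
    have h3 := h1 i
    rw [h2] at h3
    rw [SemidirectProduct.one_left, Pi.one_apply, map_one]
    exact (eq_of_units_smul_eq hinv (h0 i) ((one_smul _ _).trans h3)).symm
  have hFrange : F.range = MulAction.stabilizer G (Set.range v ∪ Set.range (-v)) := by
    ext g
    constructor
    · have hsub : ∀ h, F h • (Set.range v ∪ Set.range (-v)) ⊆ Set.range v ∪ Set.range (-v) := by
        rintro h _ ⟨x, hx, rfl⟩
        obtain ⟨ε, i, rfl⟩ := mem_range_union_neg_iff.1 hx
        simp only [smul_units_smul (G := G), hF, smul_smul]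
        exact mem_range_union_neg_iff.2 ⟨_, _, rfl⟩
      rintro ⟨h, rfl⟩
      refine MulAction.mem_stabilizer_iff.2 ((hsub h).antisymm ?_)
      rw [Set.subset_smul_set_iff, ← map_inv]
      exact hsub _
    · intro hg
      have h1 : ∀ i, ∃ (ε : ℤˣ) (j : Fin m), g • v i = ε • v j := fun i => by
        rw [← mem_range_union_neg_iff, ← MulAction.mem_stabilizer_iff.1 hg]
        exact Set.smul_mem_smul_set (Or.inl ⟨i, rfl⟩)
      choose ε σ hσ using h1
      have hinj : Function.Injective σ := by
        intro i j hij
        -- Cross-multiplying by the signs turns $\sigma(i)=\sigma(j)$ into $g(\varepsilon_j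
        -- v_i)=g(\varepsilon_i v_j)$.
        refine hne i j (ε j) (ε i) (MulAction.injective g ?_)
        simp only [smul_units_smul (G := G), hσ, hij, smul_smul, mul_comm]
      let τ : Equiv.Perm (Fin m) := Equiv.ofBijective σ (Finite.injective_iff_bijective.1 hinj)
      have hsurj : ∀ δ : ℤˣ, ∃ a, zmodTwoSign a = δ := by
        intro δ
        rcases Int.units_eq_one_or δ with rfl | rfl
        · exact ⟨1, map_one _⟩
        · exact ⟨_, zmodTwoSign_ofAdd_one⟩
      choose a ha using hsurj
      refine ⟨⟨fun i => a (ε (τ.symm i)), τ⟩, hfree _ _ (funext fun i => ?_)⟩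
      rw [Pi.smul_apply, Pi.smul_apply, hF, hσ, ha, Equiv.symm_apply_apply]
      rfl
  let Φ : HyperoctahedralGroup m ≃* MulAction.stabilizer G (Set.range v ∪ Set.range (-v)) :=
    (MonoidHom.ofInjective hFinj).trans (MulEquiv.subgroupCongr hFrange)
  have hclosure : F.range = Subgroup.closure
      (Set.range (fun i => F (SemidirectProduct.inl
        (Pi.mulSingle i (Multiplicative.ofAdd (1 : ZMod 2))))) ∪
      Set.range fun σ => F (SemidirectProduct.inr σ)) := by
    refine le_antisymm ?_ ((Subgroup.closure_le _).2 ?_)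
    · rintro _ ⟨h, rfl⟩
      rw [← SemidirectProduct.inl_left_mul_inr_right h, map_mul]
      refine mul_mem ?_ (Subgroup.subset_closure (Or.inr ⟨_, rfl⟩))
      refine Subgroup.pi_mem_of_mulSingle_mem
        (H := (Subgroup.closure _).comap (F.comp SemidirectProduct.inl)) _ fun i => ?_
      have hz : ∀ z : Multiplicative (ZMod 2), z = 1 ∨ z = Multiplicative.ofAdd 1 := by decide
      rcases hz (h.left i) with hi | hi
      · rw [hi, Pi.mulSingle_one]
        exact one_mem _
      · rw [hi]
        exact Subgroup.subset_closure (Or.inl ⟨i, rfl⟩)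
    · rintro _ (⟨i, rfl⟩ | ⟨σ, rfl⟩) <;> exact ⟨_, rfl⟩
  refine ⟨_, _, fun i g => ?_, fun σ g => ?_, hFrange.symm.trans hclosure, Φ,
    fun i => rfl, fun σ => rfl⟩
  · rw [← (show Function.Injective fun g : G => g • v from fun g h => hfree g h).eq_iff]
    have : F (SemidirectProduct.inl (Pi.mulSingle i (Multiplicative.ofAdd (1 : ZMod 2)))) • v =
        Function.update v i (-v i) := by
      funext j
      rw [Pi.smul_apply, hF]
      by_cases hij : j = i
      · subst hij
        simp [zmodTwoSign_ofAdd_one]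
      · simp [hij]
    exact ⟨fun h => h.trans this.symm, fun h => Eq.trans h this⟩
  · rw [← (show Function.Injective fun g : G => g • v from fun g h => hfree g h).eq_iff]
    have : F (SemidirectProduct.inr σ) • v = fun i => v (σ i) := by
      funext j
      rw [Pi.smul_apply, hF]
      simp
    exact ⟨fun h => h.trans this.symm, fun h => Eq.trans h this⟩

end SignedPermutations

/-! ### Commuting sign changes bound the rank from below. -/

namespace Interpretation

variable {L : FirstOrder.Language.{w₁, w₂}} {M : Type u} [L.Structure M]

section SignChanges

variable {V : Type u} [AddCommGroup V] {J : Interpretation L M V} {m : ℕ}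

/-- The product of `1 + T j` over `j < k`, for commuting involutions `T j`. -/
theorem exists_projection (hV : IsDefinableAddGroup J) {T : Fin m → AddMonoid.End V}
    (hT : ∀ i, J.DefinableMap J (T i)) (hcomm : ∀ i j x, T i (T j x) = T j (T i x))
    (hsq : ∀ i x, T i (T i x) = x) {v : Fin m → V} (hv : ∀ i j, i ≠ j → T i (v j) = v j)
    (k : ℕ) (hk : k ≤ m) :
    ∃ q : AddMonoid.End V, J.DefinableMap J q ∧ (∀ j x, T j (q x) = q (T j x)) ∧
      (∀ j : Fin m, j < k → ∀ x, T j (q x) = q x) ∧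
      ∀ i : Fin m, k ≤ i → q (v i) = 2 ^ k • v i := by
  induction k with
  | zero => exact ⟨1, J.definableMap_id, fun _ _ => rfl, fun _ h => absurd h (Nat.not_lt_zero _),
      fun i _ => by simp⟩
  | succ k ih =>
    obtain ⟨q, hq, hqT, hqf, hqv⟩ := ih (Nat.le_of_succ_le hk)
    let t : Fin m := ⟨k, hk⟩
    have hadd : ∀ x, (q + T t * q) x = q x + T t (q x) := fun _ => rfl
    -- The new factor $1+T_t$ has image fixed by $T_t$, because $T_t^2=1$, and doubles each
    -- remaining $v_i$.
    refine ⟨q + T t * q, hq.add hV ((hT t).comp hq), fun j x => ?_, fun j hj x => ?_,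
      fun i hi => ?_⟩
    · simp only [hadd, map_add, hcomm j, hqT]
    · simp only [hadd, map_add, hcomm j]
      rcases Nat.lt_succ_iff_lt_or_eq.1 hj with h | h
      · rw [hqf j h]
      · obtain rfl : j = t := Fin.ext h
        rw [hsq, add_comm]
    · have hti : t ≠ i := fun h => by
        rw [← h] at hi
        exact absurd hi (Nat.not_succ_le_self k)
      rw [hadd, hqv i (Nat.le_of_succ_le hi), map_nsmul, hv t i hti, ← add_nsmul, pow_succ, mul_two]

/-- A connected group without involutions has rank at least `m` if it has `m` commuting definable
involutive automorphisms that change the signs of the entries of an `m`-tuple. -/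
theorem rankGE_of_sign_changes (hV : IsDefinableAddGroup J) (hconn : IsConnectedGroup J)
    (hinv : ∀ x : V, x + x = 0 → x = 0) {T : Fin m → AddMonoid.End V}
    (hT : ∀ i, J.DefinableMap J (T i)) (hcomm : ∀ i j x, T i (T j x) = T j (T i x))
    (hsq : ∀ i x, T i (T i x) = x) {v : Fin m → V} (h0 : ∀ i, v i ≠ 0)
    (hv : ∀ i j, i ≠ j → T i (v j) = v j) (hneg : ∀ i, T i (v i) = -v i) :
    J.RankGE m Set.univ := by
  have hpow : ∀ (k : ℕ) (x : V), 2 ^ k • x = 0 → x = 0 := by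
    intro k x hx
    induction k with
    | zero => simpa using hx
    | succ k ih =>
      refine ih (hinv _ ?_)
      rwa [← add_nsmul, ← mul_two, ← pow_succ]
  let F : ℕ → AddSubgroup V := fun k =>
    { carrier := {x | ∀ j : Fin m, j < k → T j x = x}
      zero_mem' := fun j _ => map_zero _
      add_mem' := fun ha hb j hj => by rw [map_add, ha j hj, hb j hj]
      neg_mem' := fun ha j hj => by rw [map_neg, ha j hj] }
  have hF : ∀ k x, x ∈ F k ↔ ∀ j : Fin m, j < k → T j x = x := fun _ _ => Iff.rfl
  have hFdef : ∀ k, J.DefinableSet (F k : Set V) := by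
    intro k
    have h := DefinableSet.iInter (I := J) (S := fun j : {j : Fin m // j < k} =>
      {x | T j x = x}) fun j => (hT j).definableSet_eq J.definableMap_id
    convert h using 1
    ext x
    simp [hF]
  have hmono : ∀ k, F (k + 1) ≤ F k := fun k x hx j hj => hx j (Nat.lt_succ_of_lt hj)
  have key : ∀ k ≤ m, J.RankGE (m - k) (F k : Set V) := by
    intro k hk
    induction hk using Nat.decreasingInduction with
    | self =>
      rw [Nat.sub_self]
      exact ⟨0, zero_mem _⟩
    | of_succ k hk ih =>
      obtain ⟨q, hq, hqT, hqf, hqv⟩ := exists_projection hV hT hcomm hsq hv k hk.le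
      let t : Fin m := ⟨k, hk⟩
      -- Working with a kernel in $V$ rather than with $F_{k+1}$ in $F_k$ means that only $V$ has to
      -- be connected.
      have hker : ¬ (q - T t * q).ker.FiniteIndex := by
        intro hfin
        have hdef : J.DefinableSet ((q - T t * q).ker : Set V) := by
          have h := hq.definableSet_eq ((hT t).comp hq)
          convert h using 1
          ext x
          exact sub_eq_zero
        have h1 : v t ∈ (q - T t * q).ker := by
          rw [hconn _ hdef hfin]
          trivial
        have h2 : q (v t) - T t (q (v t)) = 0 := h1
        rw [hqv t le_rfl, map_nsmul, hneg, smul_neg, sub_neg_eq_add, ← add_nsmul, ← mul_two,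
          ← pow_succ] at h2
        exact h0 t (hpow _ _ h2)
      obtain ⟨c, hc⟩ := AddSubgroup.exists_seq_sub_notMem hker
      have hmk : m - k = m - (k + 1) + 1 := by omega
      rw [hmk]
      -- The cosets $q(c_i)+F_{k+1}$ lie in $F_k$. They are disjoint: if two met, $T_t$ would fix
      -- $q(c_i-c_j)$, putting $c_i-c_j$ in the kernel.
      refine ⟨fun i => {x | x + -q (c i) ∈ F (k + 1)}, fun i => ⟨?_, ?_, ?_⟩, fun i j hij => ?_⟩
      · exact (definableMap_add_const hV _).preimage (hFdef _)
      · intro x hx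
        have h1 : q (c i) ∈ F k := fun j hj => hqf j hj _
        exact ((F k).add_mem_cancel_right (neg_mem h1)).1 (hmono k hx)
      · exact (rankGE_translate hV _ (hFdef _)).2 ih
      · refine Set.disjoint_left.2 fun x hx hx' => hc i j hij ?_
        have h1 : q (c i - c j) ∈ F (k + 1) := by
          have := (F (k + 1)).sub_mem hx' hx
          rw [map_sub]
          convert this using 1
          abel
        exact sub_eq_zero.2 (h1 t k.lt_succ_self).symm
  exact (key 0 m.zero_le).mono (Set.subset_univ _)

end SignChanges

/-! ### Uniqueness and symmetries of the generic orbit. -/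

section GenericOrbits

variable {G V : Type u} [Group G] [AddCommGroup V] [DistribMulAction G V]
  {I : Interpretation L M G} {J : Interpretation L M V} {m : ℕ} {A : Set (Fin m → V)}

theorem definableMap_smul (hGV : IsDefinableAction I J) (g : G) :
    J.DefinableMap J fun x => g • x :=
  DefinableMap.comp (I := J) (J := I.prod J) (g := fun p => p.1 • p.2) hGV
    ((J.definableMap_const I g).pair J.definableMap_id)

theorem definableMap_units_smul (hV : IsDefinableAddGroup J) (ε : ℤˣ) :
    J.DefinableMap J fun x => ε • x := by
  rcases Int.units_eq_one_or ε with rfl | rfl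
  · simpa using J.definableMap_id
  · simpa using definableMap_neg hV

/-- Two generic orbits coincide. -/
theorem _root_.IsGenericOrbit.eq (hM : IsRanked L M) (hV : IsDefinableAddGroup J)
    (hconn : IsConnectedGroup J) {B : Set (Fin m → V)} (hA : IsGenericOrbit G J m A)
    (hB : IsGenericOrbit G J m B) : A = B := by
  obtain ⟨hAg, a, rfl⟩ := hA
  obtain ⟨hBg, b, rfl⟩ := hB
  obtain ⟨x, hxa, hxb⟩ := hAg.inter_nonempty hM (isDefinableAddGroup_pow hV m)
    (isConnectedGroup_pow hconn m) hBg
  rw [← MulAction.orbit_eq_iff.2 hxa, MulAction.orbit_eq_iff.2 hxb]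

/-- A generic orbit contains the signed permutations of its elements. -/
theorem _root_.IsGenericOrbit.exists_smul_eq (hM : IsRanked L M) (hV : IsDefinableAddGroup J)
    (hconn : IsConnectedGroup J) (hA : IsGenericOrbit G J m A) {v : Fin m → V} (hv : v ∈ A)
    (ε : Fin m → ℤˣ) (σ : Equiv.Perm (Fin m)) :
    ∃ g : G, g • v = fun i => ε (σ i) • v (σ i) := by
  let φ : (Fin m → V) → Fin m → V := fun w i => ε (σ i) • w (σ i)
  have hφ : (J.pow m).DefinableMap (J.pow m) φ := DefinableMap.pi fun i =>
    (definableMap_units_smul hV _).comp (definableMap_apply (σ i))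
  have hφinj : Function.Injective φ := by
    intro w w' h
    funext i
    have := congrFun h (σ.symm i)
    simpa [φ] using this
  have hφG : ∀ (g : G) w, φ (g • w) = g • φ w := fun g w => funext fun i =>
    (smul_units_smul g _ _).symm
  obtain ⟨⟨hAd, N, hAN, hN⟩, a, rfl⟩ := hA
  -- As $\varphi$ commutes with $G$ and preserves rank, it maps the generic orbit to a generic
  -- orbit.
  have hφA : IsGenericOrbit G J m (φ '' MulAction.orbit G a) := by
    refine ⟨⟨hφ.image hAd, N, (hasRank_image_iff hφ hAd hφinj.injOn).2 hAN, hN⟩, φ a, ?_⟩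
    ext w
    constructor
    · rintro ⟨_, ⟨g, rfl⟩, rfl⟩
      exact ⟨g, (hφG g a).symm⟩
    · rintro ⟨g, rfl⟩
      exact ⟨g • a, ⟨g, rfl⟩, hφG g a⟩
  have hAeq := IsGenericOrbit.eq hM hV hconn hφA ⟨⟨hAd, N, hAN, hN⟩, a, rfl⟩
  have h : φ v ∈ MulAction.orbit G a := hAeq ▸ ⟨v, hv, rfl⟩
  rwa [← MulAction.orbit_eq_iff.2 hv] at h

/-- A zero coordinate stays zero along the orbit, which would confine a generic set to the proper
subgroup $x_i=0$. -/
theorem _root_.IsGenericOrbit.apply_ne_zero (hM : IsRanked L M) (hV : IsDefinableAddGroup J)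
    (hconn : IsConnectedGroup J) [Nontrivial V] (hA : IsGenericOrbit G J m A) {v : Fin m → V}
    (hv : v ∈ A) (i : Fin m) : v i ≠ 0 := by
  intro h0
  let H : AddSubgroup (Fin m → V) := (Pi.evalAddMonoidHom (fun _ => V) i).ker
  have hAH : A ⊆ H := by
    obtain ⟨-, a, rfl⟩ := hA
    rw [← MulAction.orbit_eq_iff.2 hv]
    rintro _ ⟨g, rfl⟩
    change g • v i = 0
    rw [h0, smul_zero]
  have hH := hA.1.eq_top_of_subset hM (isDefinableAddGroup_pow hV m)
    (isConnectedGroup_pow hconn m) hAH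
  obtain ⟨x, hx⟩ := exists_ne (0 : V)
  have h1 : (fun _ => x) ∈ H := by
    rw [hH]
    trivial
  exact hx h1

end GenericOrbits

end Interpretation

/-! ### The theorem. -/

open Interpretation in
theorem mainTheorem3 {L : FirstOrder.Language.{w₁, w₂}} {M : Type u} [L.Structure M]
    (hM : IsRanked L M)
    {G V : Type u} [Group G] [AddCommGroup V] [DistribMulAction G V]
    (I : Interpretation L M G) (J : Interpretation L M V)
    (hG : IsDefinableGroup I) (hV : IsDefinableAddGroup J) (hGV : IsDefinableAction I J)
    (hconn : IsConnectedGroup J) (hinv : ∀ x : V, x + x = 0 → x = 0)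
    (n m : ℕ) (hn : J.HasRank Set.univ n) (hn1 : 1 ≤ n) (hmn : n ≤ m)
    (hsharp : IsGenericallySharplyTransitive G J m)
    (A : Set (Fin m → V)) (hA : IsGenericOrbit G J m A)
    (v : Fin m → V) (hv : v ∈ A) :
    (∃ (e : Fin m → G) (s : Equiv.Perm (Fin m) → G),
      (∀ i g, g • v = Function.update v i (-v i) ↔ g = e i) ∧
      (∀ σ g, (g • v = fun i => v (σ i)) ↔ g = s σ) ∧
      MulAction.stabilizer G (Set.range v ∪ Set.range (-v)) =
        Subgroup.closure (Set.range e ∪ Set.range s) ∧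
      ∃ Φ : HyperoctahedralGroup m ≃*
          MulAction.stabilizer G (Set.range v ∪ Set.range (-v)),
        (∀ i, (Φ (SemidirectProduct.inl
          (Pi.mulSingle i (Multiplicative.ofAdd (1 : ZMod 2)))) : G) = e i) ∧
        ∀ σ, (Φ (SemidirectProduct.inr σ) : G) = s σ) ∧
    m = n := by
  have : Nontrivial V := by
    obtain ⟨B, hB, hd⟩ := hn.1.of_le hn1
    obtain ⟨x, hx⟩ := (hB 0).2.2
    obtain ⟨y, hy⟩ := (hB 1).2.2
    refine ⟨x, y, ?_⟩
    rintro rfl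
    exact Set.disjoint_left.1 (hd 0 1 zero_ne_one) hx hy
  have hfree : ∀ g h : G, g • v = h • v → g = h := by
    -- Trivial stabilisers are given on some generic orbit $B$; uniqueness of the generic orbit
    -- identifies it with $A$.
    obtain ⟨B, hB, hstab⟩ := hsharp
    intro g h hgh
    have h1 : h⁻¹ * g ∈ MulAction.stabilizer G v := by
      rw [MulAction.mem_stabilizer_iff, mul_smul, hgh, inv_smul_smul]
    rw [hstab v (hA.eq hM hV hconn hB ▸ hv), Subgroup.mem_bot] at h1
    exact (inv_mul_eq_one.1 h1).symm
  have h0 := hA.apply_ne_zero hM hV hconn hv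
  have hmain := exists_hyperoctahedral_equiv hinv h0 hfree (hA.exists_smul_eq hM hV hconn hv)
  refine ⟨hmain, le_antisymm (hn.le_of_rankGE ?_) hmn⟩
  obtain ⟨e, -, he, -⟩ := hmain
  have hself : ∀ i, e i • v i = -v i := fun i => by
    simpa using congrFun ((he i _).2 rfl) i
  have hother : ∀ i j, i ≠ j → e i • v j = v j := fun i j hij => by
    simpa [hij.symm] using congrFun ((he i _).2 rfl) j
  -- Relations among the `e i` need only be checked on `v`, whose stabiliser is trivial.
  have hcomm : ∀ i j, e i * e j = e j * e i := by
    refine fun i j => hfree _ _ (funext fun l => ?_)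
    simp only [Pi.smul_apply, mul_smul]
    rcases eq_or_ne i l with rfl | hi <;> rcases eq_or_ne j i with rfl | hj
    · rfl
    · simp [hself, hother j i hj]
    · rfl
    · rcases eq_or_ne j l with rfl | hl
      · simp [hself, hother i j hi]
      · simp [hother i l hi, hother j l hl]
  have hsq : ∀ i, e i * e i = 1 := by
    refine fun i => hfree _ _ (funext fun l => ?_)
    simp only [Pi.smul_apply, mul_smul, one_smul]
    rcases eq_or_ne i l with rfl | hi
    · simp [hself]
    · simp [hother i l hi]
  exact rankGE_of_sign_changes hV hconn hinv
    (T := fun i => DistribMulAction.toAddMonoidEnd G V (e i))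
    (fun i => definableMap_smul hGV (e i))
    (fun i j x => by
      change e i • e j • x = e j • e i • x
      rw [← mul_smul, hcomm, mul_smul])
    (fun i x => by
      change e i • e i • x = x
      rw [← mul_smul, hsq, one_smul]) h0 hother hself
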